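/- Let $k$ be a field with $\operatorname{char} k\neq 2$, let $n\ge 1$, and let $X^s=(x_{ij})$ be the generic symmetric $2n\times 2n$ matrix, with $x_{ij}=x_{ji}$ and the entries $x_{ij}$, $i\le j$, independent variables. Its Hafnian is $$\mathrm{Hf}(X^s)=\sum_{\tau\in F_{2n}}x_{\tau(1)\tau(2)}x_{\tau(3)\tau(4)}\cdots x_{\tau(2n-1)\tau(2n)},$$ where $F_{2n}$ is the set of permutations $\tau$ of $\{1,\dots,2n\}$ with $\tau(1)<\tau(3)<\dots<\tau(2n-1)$ and $\tau(2i-1)<\tau(2i)$ for $1\le i\le n$. No diagonal variable $x_{ii}$ occurs in it. Let $R$ be a polynomial ring over $k$ in variables $x_{ij}$, and let the polynomial ring $S$ in the corresponding variables $y_{ij}$ act on $R$ by contraction: bilinearly, with $y^a\circ x^b=x^{b-a}$ if $a\le b$ componentwise and $y^a\circ x^b=0$ otherwise. For a form $F\in R$ let $\mathrm{Ann}(F)=\{\Phi\in S:\Phi\circ F=0\}$ be its apolar ideal. The cactus rank $cr(F)$ is the least degree of a zero-dimensional closed subscheme $\Gamma\subset\mathbf P(R_1)=\operatorname{Proj}S$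 whose saturated homogeneous ideal $I_\Gamma$ is contained in $\mathrm{Ann}(F)$. (1) If the variables are the off-diagonal ones, $x_{ij}$ with $i<j$ (that is, $X^s$ is taken with zero diagonal), then $\mathrm{Ann}(\mathrm{Hf}(X^s))$ is generated in degree $2$, that is, by its forms of degree $2$. If the diagonal variables $x_{ii}$ are included, then $\mathrm{Ann}(\mathrm{Hf}(X^s))$ is generated by the linear forms $y_{11},\dots,y_{2n,2n}$ together with its forms of degree $2$. (2) Whether or not the diagonal variables are included, $$2^{2n-2}\le cr(\mathrm{Hf}(X^s))\le 2^{2n-1}.$$ -/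

import Mathlib

open MvPolynomial

noncomputable section

namespace Apolar

/-! ### Contraction and apolar ideals -/

section Contraction

variable {σ k : Type*} [Field k]

/-- The contraction action `Φ ∘ F` of `S = k[y_v : v ∈ σ]` on `R = k[x_v : v ∈ σ]`: it is
bilinear, and `y^a ∘ x^b` is `x^(b - a)` if `a ≤ b` and `0` otherwise (see
`contract_monomial_monomial`). Both polynomial rings are modelled by `MvPolynomial σ k`;
`F.divMonomial a` removes the factor `x^a` from every monomial divisible by it and discards the
other monomials. -/
def contract (Φ F : MvPolynomial σ k) : MvPolynomial σ k :=
  ∑ a ∈ Φ.support, coeff a Φ • F.divMonomial a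

theorem contract_eq_sum_of_subset {Φ : MvPolynomial σ k} {T : Finset (σ →₀ ℕ)}
    (hT : Φ.support ⊆ T) (F : MvPolynomial σ k) :
    contract Φ F = ∑ a ∈ T, coeff a Φ • F.divMonomial a := by
  refine Finset.sum_subset hT fun a _ ha => ?_
  rw [notMem_support_iff.mp ha, zero_smul]

theorem contract_zero_left (F : MvPolynomial σ k) : contract 0 F = 0 := by
  simp [contract]

theorem contract_add_left (Φ Ψ F : MvPolynomial σ k) :
    contract (Φ + Ψ) F = contract Φ F + contract Ψ F := by
  classical
  rw [contract_eq_sum_of_subset (T := Φ.support ∪ Ψ.support) support_add,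
    contract_eq_sum_of_subset (T := Φ.support ∪ Ψ.support) Finset.subset_union_left,
    contract_eq_sum_of_subset (Φ := Ψ) (T := Φ.support ∪ Ψ.support) Finset.subset_union_right,
    ← Finset.sum_add_distrib]
  exact Finset.sum_congr rfl fun a _ => by rw [coeff_add, add_smul]

theorem contract_add_right (Φ F G : MvPolynomial σ k) :
    contract Φ (F + G) = contract Φ F + contract Φ G := by
  simp only [contract, add_divMonomial, smul_add, Finset.sum_add_distrib]

theorem contract_zero_right (Φ : MvPolynomial σ k) : contract Φ 0 = 0 := by
  simp [contract]

theorem contract_monomial (a : σ →₀ ℕ) (c : k) (F : MvPolynomial σ k) :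
    contract (monomial a c) F = c • F.divMonomial a := by
  classical
  rw [contract_eq_sum_of_subset (T := {a}) support_monomial_subset]
  simp

theorem contract_monomial_monomial (a b : σ →₀ ℕ) (c d : k) :
    contract (monomial a c) (monomial b d) =
      open Classical in if a ≤ b then monomial (b - a) (c * d) else 0 := by
  classical
  rw [contract_monomial]
  ext m
  rw [coeff_smul, coeff_divMonomial, coeff_monomial, smul_eq_mul]
  split_ifs with h1 h2 h2
  · subst h1; simp
  · exact absurd (h1 ▸ le_self_add) h2
  · rw [coeff_monomial, if_neg, mul_zero]
    rintro rfl
    exact h1 (add_tsub_cancel_of_le h2).symm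
  · simp

theorem contract_mul (Φ Ψ F : MvPolynomial σ k) :
    contract (Φ * Ψ) F = contract Φ (contract Ψ F) := by
  induction Φ using MvPolynomial.induction_on' with
  | add p q hp hq => rw [add_mul, contract_add_left, contract_add_left, hp, hq]
  | monomial a c =>
    induction Ψ using MvPolynomial.induction_on' with
    | add p q hp hq =>
      rw [mul_add, contract_add_left, contract_add_left, contract_add_right, hp, hq]
    | monomial b d =>
      rw [monomial_mul, contract_monomial, contract_monomial, contract_monomial]
      ext m
      simp only [coeff_smul, coeff_divMonomial, smul_eq_mul]
      rw [mul_assoc, add_assoc, add_left_comm]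

/-- The apolar ideal `Ann(F) = {Φ ∈ S | Φ ∘ F = 0}`. -/
def apolarIdeal (F : MvPolynomial σ k) : Ideal (MvPolynomial σ k) where
  carrier := {Φ | contract Φ F = 0}
  add_mem' := fun {a b} ha hb => by
    simp only [Set.mem_ofPred_eq] at *
    rw [contract_add_left, ha, hb, add_zero]
  zero_mem' := contract_zero_left F
  smul_mem' := fun c x hx => by
    simp only [Set.mem_ofPred_eq, smul_eq_mul] at *
    rw [contract_mul, hx, contract_zero_right]

/-- The set `I_d` of forms of degree `d` that belong to the ideal `I`. -/
def formsOfDegree (I : Ideal (MvPolynomial σ k)) (d : ℕ) : Set (MvPolynomial σ k) :=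
  {Φ | Φ ∈ I ∧ Φ.IsHomogeneous d}

/-- The ideal `I` is generated in degree `d`, that is, by its forms of degree `d`. -/
def GeneratedInDegree (I : Ideal (MvPolynomial σ k)) (d : ℕ) : Prop :=
  I = Ideal.span (formsOfDegree I d)

end Contraction

/-! ### Punctual schemes and cactus rank -/

section CactusRank

variable {σ k : Type*} [Field k]

/-- The Hilbert function `d ↦ dim_k (S_d / I_d)` of `S / I` for a homogeneous ideal `I`. -/
def hilbertFunction (I : Ideal (MvPolynomial σ k)) (d : ℕ) : ℕ :=
  Module.finrank k (homogeneousSubmodule σ k d ⧸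
    (I.restrictScalars k).comap (homogeneousSubmodule σ k d).subtype)

/-- `I` is the homogeneous ideal `I_Γ ⊆ S` of a closed subscheme `Γ` of the projective space
`Proj S = P(R_1)` with `dim Γ = 0` and `deg Γ = s`. Closed subschemes of `Proj S` correspond to
the homogeneous ideals of `S` that are saturated with respect to the irrelevant ideal
`(y_v : v ∈ σ)`, and `Γ` is zero-dimensional of degree `s` when the Hilbert polynomial of `S / I_Γ`
is the positive constant `s`. -/
structure IsPunctualSchemeIdeal (I : Ideal (MvPolynomial σ k)) (s : ℕ) : Prop where
  homogeneous : ∀ Φ ∈ I, ∀ d : ℕ, homogeneousComponent d Φ ∈ I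
  saturated : ∀ Φ : MvPolynomial σ k, (∀ v : σ, X v * Φ ∈ I) → Φ ∈ I
  degree_pos : 0 < s
  hilbert : ∀ᶠ d in Filter.atTop, hilbertFunction I d = s

/-- The cactus rank `cr(F)`: the smallest degree of a zero-dimensional closed subscheme
`Γ ⊆ P(R_1)` that is apolar to `F`, that is, with `I_Γ ⊆ Ann(F)`. Degrees are positive, so the
value `0` would only mean that there is no such `Γ`. -/
def cactusRank (F : MvPolynomial σ k) : ℕ :=
  sInf {s : ℕ | ∃ I : Ideal (MvPolynomial σ k), IsPunctualSchemeIdeal I s ∧ I ≤ apolarIdeal F}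

end CactusRank

/-! ### The Hafnian of the generic symmetric matrix -/

section Hafnian

/-- The index `2i - 1` (for `i = 1, …, n`) in `0`-based numbering. -/
def oddPos {n : ℕ} (i : Fin n) : Fin (2 * n) := ⟨2 * i, by omega⟩

/-- The index `2i` (for `i = 1, …, n`) in `0`-based numbering. -/
def evenPos {n : ℕ} (i : Fin n) : Fin (2 * n) := ⟨2 * i + 1, by omega⟩

/-- The set `F_{2n}` of the permutations `τ` of `{1, …, 2n}` such that
`τ(1) < τ(3) < ⋯ < τ(2n - 1)` and `τ(2i - 1) < τ(2i)` for all `1 ≤ i ≤ n`. -/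
def matchingPerms (n : ℕ) : Finset (Equiv.Perm (Fin (2 * n))) :=
  {τ | (∀ i j : Fin n, i < j → τ (oddPos i) < τ (oddPos j)) ∧
    ∀ i : Fin n, τ (oddPos i) < τ (evenPos i)}

/-- The Hafnian
`Hf(M) = ∑_{τ ∈ F_{2n}} M_{τ(1) τ(2)} M_{τ(3) τ(4)} ⋯ M_{τ(2n-1) τ(2n)}`
of a `2n × 2n` matrix. -/
def hafnian {A : Type*} [CommRing A] {n : ℕ} (M : Matrix (Fin (2 * n)) (Fin (2 * n)) A) : A :=
  ∑ τ ∈ matchingPerms n, ∏ i : Fin n, M (τ (oddPos i)) (τ (evenPos i))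

/-- The variables `x_{ij} = x_{ji}` of the generic symmetric `2n × 2n` matrix. -/
abbrev SymVar (n : ℕ) : Type := Sym2 (Fin (2 * n))

/-- The generic symmetric `2n × 2n` matrix, with independent entries `x_{ij}` for `i ≤ j`. -/
def genericSymm (k : Type*) [Field k] (n : ℕ) :
    Matrix (Fin (2 * n)) (Fin (2 * n)) (MvPolynomial (SymVar n) k) :=
  fun i j => X s(i, j)

/-- The variables `x_{ij} = x_{ji}`, `i ≠ j`, of the generic zero-diagonal symmetric
`2n × 2n` matrix. -/
abbrev OffDiagVar (n : ℕ) : Type := {p : Sym2 (Fin (2 * n)) // ¬ p.IsDiag}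

/-- The generic zero-diagonal symmetric `2n × 2n` matrix, with independent entries `x_{ij}` for
`i < j` and zeros on the diagonal. -/
def genericSymmZeroDiag (k : Type*) [Field k] (n : ℕ) :
    Matrix (Fin (2 * n)) (Fin (2 * n)) (MvPolynomial (OffDiagVar n) k) :=
  fun i j => if h : i = j then 0 else X ⟨s(i, j), by simpa using h⟩

end Hafnian

end Apolar

end

open MvPolynomial

noncomputable section

namespace Apolar

/-! ### Hilbert functions and the lower bound for the degree of an apolar scheme. -/

section LowerBound

variable {σ k : Type*} [Field k]

/-! View `y_{ij}` as an edge of a graph on `2n` vertices, possibly a loop, and let `ε` be the map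
`y_{ij} ↦ t_i t_j` (`edgeHom`). The Hafnian is the sum of all monomials of degree one at every
vertex (`IsMatchingSum`). So, if `b` is a matching, the coefficient of `x^b` in `Φ ∘ Hf` is that of
`t_J` in `ε(Φ)`, with `J` the set of vertices missed by `b`; for other `b` it is zero. Every even
`J` occurs, hence `Ann(Hf) = ε⁻¹(t_1², …, t_{2n}²)`, and `S / Ann(Hf)` has dimension `C(2n, 2d)` in
degree `d`.

Generation (`IsMatchingSum.apolarIdeal_eq`): a monomial with a repeated vertex is divisible by a
loop or by a quadric with that repetition, and two matchings of the same vertex set are linked by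
exchanges `y_{ij} y_{lm} - y_{il} y_{jm}`.

Lower bound (`sum_hilbertFunction_le`): the squares of the variables lie in `Ann(Hf)`, so an apolar
scheme has degree at least half of the length of `S / Ann(Hf)`, and that length is at least `∑ C(2n,
2d) = 2^(2n-1)`.

Upper bound (`coeff_setDeg_eq_zero`): the points `(a_i a_j)` with `a ∈ {±1}^{2n}`, taken up to a
global sign, are apolar to the Hafnian, by orthogonality of characters of `{±1}^{2n}`. This is where
`char k ≠ 2` enters. -/

instance finite_homogeneousSubmodule [Finite σ] (d : ℕ) :
    Module.Finite k (homogeneousSubmodule σ k d) :=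
  Module.Finite.iff_fg.2 (homogeneousSubmodule_fg σ k d)

/-- The image of `K_d` in `S / I`. -/
def gradedImage (I K : Ideal (MvPolynomial σ k)) (d : ℕ) :
    Submodule k (MvPolynomial σ k ⧸ I) :=
  (K.restrictScalars k ⊓ homogeneousSubmodule σ k d).map (Ideal.Quotient.mkₐ k I).toLinearMap

theorem mem_gradedImage {I K : Ideal (MvPolynomial σ k)} {d : ℕ} {x : MvPolynomial σ k ⧸ I} :
    x ∈ gradedImage I K d ↔
      ∃ Φ ∈ K, Φ.IsHomogeneous d ∧ Ideal.Quotient.mk I Φ = x := by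
  simp [gradedImage, Submodule.mem_map, and_assoc]

theorem mul_mem_gradedImage {I K : Ideal (MvPolynomial σ k)} {d e : ℕ}
    {x y : MvPolynomial σ k ⧸ I} (hx : x ∈ gradedImage I K d) (hy : y ∈ gradedImage I ⊤ e) :
    x * y ∈ gradedImage I K (d + e) := by
  obtain ⟨Φ, hΦ, hd, rfl⟩ := mem_gradedImage.1 hx
  obtain ⟨Ψ, -, he, rfl⟩ := mem_gradedImage.1 hy
  exact mem_gradedImage.2 ⟨Φ * Ψ, K.mul_mem_right _ hΦ, hd.mul he, map_mul _ _ _⟩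

instance finite_gradedImage [Finite σ] (I K : Ideal (MvPolynomial σ k)) (d : ℕ) :
    Module.Finite k (gradedImage I K d) := by
  have : Module.Finite k ↥(K.restrictScalars k ⊓ homogeneousSubmodule σ k d) :=
    Submodule.finiteDimensional_of_le inf_le_right
  exact inferInstanceAs (Module.Finite k (Submodule.map _ _))

theorem hilbertFunction_add_finrank [Finite σ] (I : Ideal (MvPolynomial σ k)) (d : ℕ) :
    hilbertFunction I d + Module.finrank k ↥(I.restrictScalars k ⊓ homogeneousSubmodule σ k d) =
      Module.finrank k (homogeneousSubmodule σ k d) := by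
  rw [hilbertFunction, ← Submodule.finrank_quotient_add_finrank
    ((I.restrictScalars k).comap (homogeneousSubmodule σ k d).subtype), inf_comm]
  congr 1
  rw [← Submodule.map_comap_subtype]
  exact Submodule.finrank_map_subtype_eq _ _

theorem finrank_gradedImage_add [Finite σ] {I K : Ideal (MvPolynomial σ k)} (h : I ≤ K) (d : ℕ) :
    Module.finrank k (gradedImage I K d) + hilbertFunction K d = hilbertFunction I d := by
  set V := K.restrictScalars k ⊓ homogeneousSubmodule σ k d with hV
  have : Module.Finite k V := Submodule.finiteDimensional_of_le inf_le_right
  set f := (Ideal.Quotient.mkₐ k I).toLinearMap.domRestrict V with hf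
  have h1 := LinearMap.finrank_range_add_finrank_ker f
  have h2 : LinearMap.range f = gradedImage I K d := by
    rw [hf, LinearMap.range_domRestrict]; rfl
  have h3 : Module.finrank k (LinearMap.ker f) =
      Module.finrank k ↥(I.restrictScalars k ⊓ homogeneousSubmodule σ k d) := by
    have : (LinearMap.ker f).map V.subtype = I.restrictScalars k ⊓ homogeneousSubmodule σ k d := by
      ext Φ
      simp only [Submodule.mem_map, LinearMap.mem_ker, hf, Submodule.mem_inf]
      constructor
      · rintro ⟨x, hx, rfl⟩
        exact ⟨Ideal.Quotient.eq_zero_iff_mem.1 hx, x.2.2⟩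
      · rintro ⟨hI, hd⟩
        exact ⟨⟨Φ, h hI, hd⟩, Ideal.Quotient.eq_zero_iff_mem.2 hI, rfl⟩
    rw [← this]
    exact (Submodule.finrank_map_subtype_eq _ _).symm
  have h4 := hilbertFunction_add_finrank I d
  have h5 := hilbertFunction_add_finrank K d
  rw [h2, h3, hV] at h1
  omega

theorem hilbertFunction_anti [Finite σ] {I K : Ideal (MvPolynomial σ k)} (h : I ≤ K) (d : ℕ) :
    hilbertFunction K d ≤ hilbertFunction I d := by
  have := finrank_gradedImage_add h d
  omega

/-- In a saturated ideal, the squares of the variables have no common annihilator modulo it. -/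
theorem mem_of_forall_X_sq_mul_mem [Finite σ] {I : Ideal (MvPolynomial σ k)}
    (hI : ∀ Φ : MvPolynomial σ k, (∀ v : σ, X v * Φ ∈ I) → Φ ∈ I) {Φ : MvPolynomial σ k}
    (hΦ : ∀ v, X v ^ 2 * Φ ∈ I) : Φ ∈ I := by
  classical
  have := Fintype.ofFinite σ
  have key : ∀ N : ℕ, (∀ a : σ →₀ ℕ, N ≤ a.degree → monomial a (1 : k) * Φ ∈ I) → Φ ∈ I := by
    intro N
    induction N with
    | zero => intro h; simpa using h 0 (Nat.zero_le _)
    | succ N ih =>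
      intro h
      refine ih fun a ha => hI _ fun v => ?_
      have := h (Finsupp.single v 1 + a) (by rw [map_add, Finsupp.degree_single]; omega)
      rwa [← mul_one (1 : k), ← monomial_mul, mul_assoc] at this
  -- Pigeonhole: a monomial of degree exceeding the number of variables is divisible by the square
  -- of one of them.
  refine key (Fintype.card σ + 1) fun a ha => ?_
  obtain ⟨v, hv⟩ : ∃ v, 2 ≤ a v := by
    by_contra! hlt
    have : a.degree ≤ Fintype.card σ := by
      rw [Finsupp.degree_eq_sum]
      simpa using Finset.sum_le_card_nsmul Finset.univ a 1 fun v _ => Nat.le_of_lt_succ (hlt v)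
    omega
  have hle : Finsupp.single v 2 ≤ a := Finsupp.single_le_iff.2 hv
  rw [← tsub_add_cancel_of_le hle, ← mul_one (1 : k), ← monomial_mul, mul_assoc]
  refine I.mul_mem_left _ ?_
  simpa [X_pow_eq_monomial] using hΦ v

/-- The generic combination `∑ i, t ^ i * y_i ^ 2` of the squares of the variables. -/
def genericQuadric (I : Ideal (MvPolynomial σ k)) {D : ℕ} (v : Fin D → σ) :
    Polynomial (MvPolynomial σ k ⧸ I) :=
  ∑ i : Fin D, Polynomial.monomial (i : ℕ) (Ideal.Quotient.mk I (X (v i) ^ 2))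

theorem coeff_genericQuadric (I : Ideal (MvPolynomial σ k)) {D : ℕ} (v : Fin D → σ) (i : ℕ) :
    (genericQuadric I v).coeff i =
      if h : i < D then Ideal.Quotient.mk I (X (v ⟨i, h⟩) ^ 2) else 0 := by
  rw [genericQuadric, Polynomial.finsetSum_coeff]
  simp only [Polynomial.coeff_monomial]
  split_ifs with h
  · rw [Finset.sum_eq_single ⟨i, h⟩]
    · simp
    · intro j _ hj
      rw [if_neg]
      rintro rfl
      exact hj rfl
    · simp
  · refine Finset.sum_eq_zero fun j _ => if_neg ?_
    rintro rfl
    exact h j.2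

/-- McCoy's theorem: a zero divisor in `(S / I)[t]` is killed by a nonzero constant, which then
kills all the squares `y_i²`; saturation forbids this. Using an indeterminate `t` instead of a
general scalar covers finite fields. -/
theorem genericQuadric_mem_nonZeroDivisors [Finite σ] {I : Ideal (MvPolynomial σ k)}
    (hI : ∀ Φ : MvPolynomial σ k, (∀ v : σ, X v * Φ ∈ I) → Φ ∈ I) {D : ℕ} (v : Fin D ≃ σ) :
    genericQuadric I v ∈ nonZeroDivisors (Polynomial (MvPolynomial σ k ⧸ I)) := by
  by_contra h
  obtain ⟨a, ha, h0⟩ := Polynomial.notMem_nonZeroDivisors_iff.1 h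
  obtain ⟨Φ, rfl⟩ := Ideal.Quotient.mk_surjective a
  refine ha (Ideal.Quotient.eq_zero_iff_mem.2 (mem_of_forall_X_sq_mul_mem hI fun w => ?_))
  have h1 := congrArg (fun p => Polynomial.coeff p ((v.symm w : Fin D) : ℕ)) h0
  simp only [Polynomial.coeff_smul, coeff_genericQuadric, Fin.is_lt, dite_true, Fin.eta,
    Equiv.apply_symm_apply, Polynomial.coeff_zero, smul_eq_mul, ← map_mul] at h1
  rw [mul_comm]
  exact Ideal.Quotient.eq_zero_iff_mem.1 h1

theorem coeff_genericQuadric_mem {I K : Ideal (MvPolynomial σ k)} (hK : ∀ v : σ, X v ^ 2 ∈ K)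
    {D : ℕ} (v : Fin D → σ) (i : ℕ) : (genericQuadric I v).coeff i ∈ gradedImage I K 2 := by
  rw [coeff_genericQuadric]
  split_ifs
  · exact mem_gradedImage.2 ⟨_, hK _, by simpa using (isHomogeneous_X k _).pow 2, rfl⟩
  · exact zero_mem _

/-- Multiplication by the generic quadric, of degree less than `Nat.card σ` in `t`, embeds the
polynomials in `t` of degree less than `N` over `(S / I)_d` into those of degree less than `N +
Nat.card σ` over `(K / I)_{d+2}`. -/
theorem mul_finrank_gradedImage_le [Finite σ] {I K : Ideal (MvPolynomial σ k)}
    (hI : ∀ Φ : MvPolynomial σ k, (∀ v : σ, X v * Φ ∈ I) → Φ ∈ I)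
    (hK : ∀ v : σ, X v ^ 2 ∈ K) (d N : ℕ) :
    N * Module.finrank k (gradedImage I ⊤ d) ≤
      (N + Nat.card σ) * Module.finrank k (gradedImage I K (2 + d)) := by
  set D := Nat.card σ
  let v : Fin D ≃ σ := (Finite.equivFin σ).symm
  set g := genericQuadric I v
  let P : (Fin N → gradedImage I ⊤ d) →ₗ[k] Polynomial (MvPolynomial σ k ⧸ I) :=
    ∑ i : Fin N, (Polynomial.monomial (i : ℕ)).restrictScalars k ∘ₗ
      (gradedImage I ⊤ d).subtype ∘ₗ LinearMap.proj i
  have hPcoeff : ∀ f (i : ℕ), (P f).coeff i = if h : i < N then (f ⟨i, h⟩ : _ ⧸ I) else 0 := by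
    intro f i
    simp only [P, LinearMap.sum_apply, Polynomial.finsetSum_coeff, LinearMap.comp_apply,
      LinearMap.restrictScalars_apply, Polynomial.coeff_monomial, LinearMap.proj_apply,
      Submodule.subtype_apply]
    split_ifs with h
    · rw [Finset.sum_eq_single ⟨i, h⟩]
      · simp
      · intro j _ hj
        rw [if_neg]
        rintro rfl
        exact hj rfl
      · simp
    · refine Finset.sum_eq_zero fun j _ => if_neg ?_
      rintro rfl
      exact h j.2
  have hmem : ∀ f (i : ℕ), (g * P f).coeff i ∈ gradedImage I K (2 + d) := by
    intro f i
    rw [Polynomial.coeff_mul]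
    refine Submodule.sum_mem _ fun x _ => mul_mem_gradedImage (coeff_genericQuadric_mem hK _ _) ?_
    rw [hPcoeff]
    split_ifs
    · exact Subtype.property _
    · exact zero_mem _
  have hvanish : ∀ f (i : ℕ), N + D ≤ i → (g * P f).coeff i = 0 := by
    intro f i hi
    rw [Polynomial.coeff_mul]
    refine Finset.sum_eq_zero fun x hx => ?_
    have hx := Finset.HasAntidiagonal.mem_antidiagonal.1 hx
    rw [hPcoeff, coeff_genericQuadric]
    split_ifs <;> first | omega | simp
  let L : (Fin N → gradedImage I ⊤ d) →ₗ[k] (Fin (N + D) → gradedImage I K (2 + d)) :=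
    LinearMap.pi fun j => LinearMap.codRestrict _
      ((Polynomial.lcoeff _ (j : ℕ)).restrictScalars k ∘ₗ LinearMap.mulLeft k g ∘ₗ P)
      fun f => hmem f j
  have hL : Function.Injective L := by
    rw [← LinearMap.ker_eq_bot, LinearMap.ker_eq_bot']
    intro f hf
    have h0 : g * P f = 0 := by
      ext i
      rcases lt_or_ge i (N + D) with hi | hi
      · exact congrArg Subtype.val (congrFun hf ⟨i, hi⟩)
      · exact hvanish f i hi
    have hP : P f = 0 :=
      (mem_nonZeroDivisors_iff.1 (genericQuadric_mem_nonZeroDivisors hI v)).1 _ h0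
    refine funext fun i => Subtype.ext ?_
    have := hPcoeff f i
    rw [hP, Polynomial.coeff_zero, dif_pos i.2] at this
    exact this.symm
  simpa [Module.finrank_pi_fintype] using LinearMap.finrank_le_finrank_of_injective hL

/-- If `I ⊆ K` with `I` saturated and `K` containing the squares of the variables, then a general
quadric in `K` is a nonzerodivisor modulo `I`, whence this inequality of Hilbert functions. -/
theorem hilbertFunction_add_le [Finite σ] {I K : Ideal (MvPolynomial σ k)} (hIK : I ≤ K)
    (hI : ∀ Φ : MvPolynomial σ k, (∀ v : σ, X v * Φ ∈ I) → Φ ∈ I)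
    (hK : ∀ v : σ, X v ^ 2 ∈ K) (d : ℕ) :
    hilbertFunction K (2 + d) + hilbertFunction I d ≤ hilbertFunction I (2 + d) := by
  have h1 := finrank_gradedImage_add hIK (2 + d)
  have h2 := finrank_gradedImage_add (le_top : I ≤ ⊤) d
  have h3 := hilbertFunction_add_finrank (⊤ : Ideal (MvPolynomial σ k)) d
  have h4 : Module.finrank k ↥((⊤ : Ideal (MvPolynomial σ k)).restrictScalars k ⊓
      homogeneousSubmodule σ k d) = Module.finrank k (homogeneousSubmodule σ k d) := by
    rw [Submodule.restrictScalars_top, top_inf_eq]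
  set a := Module.finrank k (gradedImage I ⊤ d)
  set b := Module.finrank k (gradedImage I K (2 + d))
  have hle : a ≤ b := by
    have hN : ∀ N, N * a ≤ (N + Nat.card σ) * b := mul_finrank_gradedImage_le hI hK d
    by_contra! hlt
    -- As `N → ∞` the ratio `(N + Nat.card σ) / N` tends to one; this `N` already contradicts `b + 1
    -- ≤ a`.
    have h5 := hN (Nat.card σ * b + 1)
    have h6 := Nat.mul_le_mul_left (Nat.card σ * b + 1) (Nat.succ_le_of_lt hlt)
    rw [Nat.succ_eq_add_one] at h6
    nlinarith
  omega

/-- A special case of the Ranestad–Schreyer bound: the degree of a punctual scheme whose ideal is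
contained in `K` is at least half of the length of `S / K` if `K` contains the squares of the
variables. -/
theorem sum_hilbertFunction_le [Finite σ] {I K : Ideal (MvPolynomial σ k)} {s : ℕ} (hIK : I ≤ K)
    (hI : IsPunctualSchemeIdeal I s) (hK : ∀ v : σ, X v ^ 2 ∈ K) (N : ℕ) :
    ∑ d ∈ Finset.range N, hilbertFunction K d ≤ 2 * s := by
  -- The inequality telescopes in steps of two, once for each parity; hence two consecutive values
  -- of the Hilbert function of `I`, and the factor `2` in the bound.
  have key : ∀ M, ∑ d ∈ Finset.range (M + 2), hilbertFunction K d ≤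
      hilbertFunction I M + hilbertFunction I (M + 1) := by
    intro M
    induction M with
    | zero =>
      simpa [Finset.sum_range_succ] using
        add_le_add (hilbertFunction_anti hIK 0) (hilbertFunction_anti hIK 1)
    | succ M ih =>
      rw [Finset.sum_range_succ]
      have := hilbertFunction_add_le hIK hI.saturated hK M
      rw [add_comm 2 M] at this
      rw [show M + 1 + 1 = M + 2 by ring]
      omega
  obtain ⟨M, hM⟩ := Filter.eventually_atTop.1 hI.hilbert
  have := key (max M N)
  rw [hM _ (le_max_left _ _), hM _ ((le_max_left M N).trans (Nat.le_succ _))] at this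
  calc _ ≤ ∑ d ∈ Finset.range (max M N + 2), hilbertFunction K d :=
        Finset.sum_le_sum_of_subset (Finset.range_mono (by omega))
    _ ≤ _ := by omega

end LowerBound

/-! ### Ideals of finite sets of points. -/

section Points

variable {σ k Z : Type*} [Field k]

/-- The restriction `k[y] → k[t]` of polynomial functions to the line through `0` and `p`. -/
def restrictLine (p : σ → k) : MvPolynomial σ k →ₐ[k] Polynomial k :=
  aeval fun v => Polynomial.C (p v) * Polynomial.X

theorem restrictLine_of_isHomogeneous (p : σ → k) {Φ : MvPolynomial σ k} {d : ℕ}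
    (h : Φ.IsHomogeneous d) :
    restrictLine p Φ = Polynomial.C (eval p Φ) * Polynomial.X ^ d := by
  rw [restrictLine, aeval_def, eval₂_eq, eval_eq, map_sum, Finset.sum_mul]
  refine Finset.sum_congr rfl fun a ha => ?_
  have hd : ∑ i ∈ a.support, a i = d := (h.degree_eq_sum_deg_support ha).symm
  simp only [mul_pow, Finset.prod_mul_distrib, Finset.prod_pow_eq_pow_sum, hd, map_mul, map_prod,
    map_pow, Polynomial.algebraMap_eq, mul_assoc]

/-- Restriction to the line separates the homogeneous components, so vanishing on the line means
that every component vanishes at the point. -/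
theorem coeff_restrictLine (p : σ → k) (Φ : MvPolynomial σ k) (d : ℕ) :
    (restrictLine p Φ).coeff d = eval p (homogeneousComponent d Φ) := by
  conv_lhs => rw [← sum_homogeneousComponent Φ]
  rw [map_sum, Polynomial.finsetSum_coeff]
  simp only [restrictLine_of_isHomogeneous p (homogeneousComponent_isHomogeneous _ Φ),
    Polynomial.coeff_C_mul, Polynomial.coeff_X_pow]
  by_cases hd : d ∈ Finset.range (Φ.totalDegree + 1)
  · rw [Finset.sum_eq_single_of_mem d hd]
    · simp
    · intro i _ hi
      rw [if_neg hi.symm, mul_zero]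
  · rw [homogeneousComponent_eq_zero _ _ (by simpa using hd), map_zero]
    refine Finset.sum_eq_zero fun i hi => ?_
    rw [if_neg (by rintro rfl; exact hd hi), mul_zero]

/-- The homogeneous ideal of the set of points of projective space represented by `p z`, `z : Z`. -/
def pointsIdeal (p : Z → σ → k) : Ideal (MvPolynomial σ k) :=
  ⨅ z, RingHom.ker (restrictLine (p z))

theorem mem_pointsIdeal {p : Z → σ → k} {Φ : MvPolynomial σ k} :
    Φ ∈ pointsIdeal p ↔ ∀ z, restrictLine (p z) Φ = 0 := by
  simp [pointsIdeal, RingHom.mem_ker]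

theorem mem_pointsIdeal_iff_eval {p : Z → σ → k} {Φ : MvPolynomial σ k} :
    Φ ∈ pointsIdeal p ↔ ∀ z d, eval (p z) (homogeneousComponent d Φ) = 0 := by
  simp [mem_pointsIdeal, Polynomial.ext_iff, coeff_restrictLine]

theorem mem_pointsIdeal_of_isHomogeneous {p : Z → σ → k} {Φ : MvPolynomial σ k} {d : ℕ}
    (h : Φ.IsHomogeneous d) : Φ ∈ pointsIdeal p ↔ ∀ z, eval (p z) Φ = 0 := by
  simp [mem_pointsIdeal, restrictLine_of_isHomogeneous _ h]

/-- Evaluation of the forms of degree `d` at the points `p z`. -/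
def evalForms (p : Z → σ → k) (d : ℕ) : homogeneousSubmodule σ k d →ₗ[k] (Z → k) :=
  LinearMap.pi fun z => (aeval (p z)).toLinearMap ∘ₗ (homogeneousSubmodule σ k d).subtype

theorem evalForms_apply (p : Z → σ → k) (d : ℕ) (Φ : homogeneousSubmodule σ k d) (z : Z) :
    evalForms p d Φ z = eval (p z) Φ := by
  simp [evalForms, aeval_eq_eval]

theorem hilbertFunction_pointsIdeal (p : Z → σ → k) (d : ℕ) :
    hilbertFunction (pointsIdeal p) d = Module.finrank k (LinearMap.range (evalForms p d)) := by
  rw [hilbertFunction, ← (evalForms p d).quotKerEquivRange.finrank_eq]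
  have : ((pointsIdeal p).restrictScalars k).comap (homogeneousSubmodule σ k d).subtype =
      LinearMap.ker (evalForms p d) := by
    ext Φ
    simp only [Submodule.mem_comap, Submodule.subtype_apply, Submodule.restrictScalars_mem,
      LinearMap.mem_ker, funext_iff, evalForms_apply, Pi.zero_apply]
    exact mem_pointsIdeal_of_isHomogeneous Φ.2
  rw [this]

/-- Multiplication by `y_{v₀}` rescales the values at the points by nonzero factors, so it is
injective on value vectors. -/
theorem monotone_hilbertFunction_pointsIdeal [Finite Z] {p : Z → σ → k} {v₀ : σ}
    (hv : ∀ z, p z v₀ ≠ 0) : Monotone (hilbertFunction (pointsIdeal p)) := by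
  refine monotone_nat_of_le_succ fun d => ?_
  rw [hilbertFunction_pointsIdeal, hilbertFunction_pointsIdeal]
  let m : (Z → k) →ₗ[k] (Z → k) := LinearMap.mulLeft k fun z => p z v₀
  have hm : Function.Injective m := by
    intro f g hfg
    funext z
    exact mul_left_cancel₀ (hv z) (congrFun hfg z)
  rw [(Submodule.equivMapOfInjective m hm _).finrank_eq]
  refine Submodule.finrank_mono ?_
  rintro _ ⟨_, ⟨Φ, rfl⟩, rfl⟩
  refine ⟨⟨X v₀ * (Φ : MvPolynomial σ k), by
    simpa [add_comm] using (isHomogeneous_X k v₀).mul Φ.2⟩, ?_⟩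
  funext z
  simp [evalForms_apply, m]

/-- The Hilbert function is monotone and bounded by the number of representatives, hence eventually
constant. The degree may be smaller than that number, since distinct `z` may give the same
projective point. -/
theorem exists_isPunctualSchemeIdeal_pointsIdeal [Fintype Z] [Nonempty Z] {p : Z → σ → k} {v₀ : σ}
    (hv : ∀ z, p z v₀ ≠ 0) :
    ∃ s ≤ Fintype.card Z, IsPunctualSchemeIdeal (pointsIdeal p) s := by
  have hmono := monotone_hilbertFunction_pointsIdeal hv
  have hle : ∀ d, hilbertFunction (pointsIdeal p) d ≤ Fintype.card Z := by
    intro d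
    rw [hilbertFunction_pointsIdeal]
    simpa using Submodule.finrank_le (LinearMap.range (evalForms p d))
  obtain ⟨N, hN⟩ : ∃ N, ∀ d ≥ N,
      hilbertFunction (pointsIdeal p) d = hilbertFunction (pointsIdeal p) N := by
    have hfin : (Set.range (hilbertFunction (pointsIdeal p))).Finite :=
      (Set.finite_Iic (Fintype.card Z)).subset (by rintro _ ⟨d, rfl⟩; exact hle d)
    obtain ⟨_, ⟨⟨N, rfl⟩, hN⟩⟩ := hfin.exists_maximal (Set.range_nonempty _)
    exact ⟨N, fun d hd => le_antisymm (hN ⟨d, rfl⟩ (hmono hd)) (hmono hd)⟩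
  refine ⟨hilbertFunction (pointsIdeal p) N, hle N, ?_, ?_, ?_, ?_⟩
  · intro Φ hΦ d
    rw [mem_pointsIdeal_of_isHomogeneous (homogeneousComponent_isHomogeneous d Φ)]
    exact fun z => mem_pointsIdeal_iff_eval.1 hΦ z d
  · intro Φ hΦ
    refine mem_pointsIdeal.2 fun z => ?_
    have := mem_pointsIdeal.1 (hΦ v₀) z
    rw [map_mul] at this
    refine (mul_eq_zero.1 this).resolve_left ?_
    simpa [restrictLine] using hv z
  · refine lt_of_lt_of_le ?_ (hmono (Nat.zero_le N))
    rw [hilbertFunction_pointsIdeal, Module.finrank_pos_iff]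
    refine ⟨⟨⟨_, ⟨⟨1, isHomogeneous_one σ k⟩, rfl⟩⟩, 0, fun h => ?_⟩⟩
    have := congrFun (congrArg Subtype.val h) (Classical.arbitrary Z)
    simp [evalForms_apply] at this
  · exact Filter.eventually_atTop.2 ⟨N, hN⟩

end Points

/-! ### Vertex degrees of multigraphs and the map `y_{ij} ↦ t_i t_j`. -/

section VertexDegree

variable {ι σ k : Type*} [Field k]

/-- The degree vector of an edge: `t_i t_j` as an exponent, for the edge `{i, j}`. -/
def edgeDeg : Sym2 ι → (ι →₀ ℕ) :=
  Sym2.lift ⟨fun i j => Finsupp.single i 1 + Finsupp.single j 1, fun _ _ => add_comm _ _⟩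

theorem edgeDeg_mk (i j : ι) : edgeDeg s(i, j) = Finsupp.single i 1 + Finsupp.single j 1 := rfl

theorem one_le_edgeDeg {x : Sym2 ι} {i : ι} (h : i ∈ x) : 1 ≤ edgeDeg x i := by
  obtain ⟨j, rfl⟩ := h
  simp [edgeDeg_mk]

theorem mem_of_edgeDeg_ne_zero {x : Sym2 ι} {i : ι} (h : edgeDeg x i ≠ 0) : i ∈ x := by
  classical
  induction x with
  | _ a b =>
    by_contra hi
    rw [Sym2.mem_iff, not_or] at hi
    simp [edgeDeg_mk, Ne.symm hi.1, Ne.symm hi.2] at h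

theorem degree_edgeDeg (x : Sym2 ι) : (edgeDeg x).degree = 2 := by
  induction x with
  | _ a b => simp [edgeDeg_mk]

/-- The vector of vertex degrees of the multigraph with edges `e v` of multiplicity `m v`. -/
def vdeg (e : σ → Sym2 ι) : (σ →₀ ℕ) →+ (ι →₀ ℕ) :=
  (Finsupp.linearCombination ℕ fun v => edgeDeg (e v)).toAddMonoidHom

theorem vdeg_single (e : σ → Sym2 ι) (v : σ) (c : ℕ) :
    vdeg e (Finsupp.single v c) = c • edgeDeg (e v) := by
  simp [vdeg]

theorem degree_vdeg (e : σ → Sym2 ι) (m : σ →₀ ℕ) : (vdeg e m).degree = 2 * m.degree := by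
  induction m using Finsupp.induction_linear with
  | zero => simp
  | add f g hf hg => rw [map_add, map_add, hf, hg, map_add]; ring
  | single v c => rw [vdeg_single, map_nsmul, degree_edgeDeg]; simp [mul_comm]

theorem vdeg_mono (e : σ → Sym2 ι) {a b : σ →₀ ℕ} (h : a ≤ b) : vdeg e a ≤ vdeg e b := by
  rw [← tsub_add_cancel_of_le h, map_add]
  exact le_add_self

theorem exists_mem_support_of_vdeg_ne_zero {e : σ → Sym2 ι} {m : σ →₀ ℕ} {i : ι}
    (h : vdeg e m i ≠ 0) : ∃ v, m v ≠ 0 ∧ i ∈ e v := by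
  by_contra! hc
  refine h ?_
  rw [vdeg, LinearMap.toAddMonoidHom_coe, Finsupp.linearCombination_apply, Finsupp.sum,
    Finsupp.finsetSum_apply]
  refine Finset.sum_eq_zero fun v hv => ?_
  have := mt mem_of_edgeDeg_ne_zero (hc v (Finsupp.mem_support_iff.1 hv))
  simp [not_not.1 this]

theorem eq_of_mem_of_mem {e : σ → Sym2 ι} {m : σ →₀ ℕ} {i : ι} (h : vdeg e m i ≤ 1) {v w : σ}
    (hv : m v ≠ 0) (hw : m w ≠ 0) (hiv : i ∈ e v) (hiw : i ∈ e w) : v = w := by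
  classical
  by_contra hvw
  have hle : Finsupp.single v 1 + Finsupp.single w 1 ≤ m := by
    intro u
    simp only [Finsupp.add_apply, Finsupp.single_apply]
    split_ifs <;> grind
  have := vdeg_mono e hle i
  rw [map_add, vdeg_single, vdeg_single, Finsupp.add_apply, one_smul, one_smul] at this
  have h1 := one_le_edgeDeg hiv
  have h2 := one_le_edgeDeg hiw
  omega

/-- The exponent of the squarefree monomial `∏ i ∈ J, t_i`. -/
def setDeg (J : Finset ι) : ι →₀ ℕ := ∑ i ∈ J, Finsupp.single i 1

open Classical in
theorem setDeg_apply (J : Finset ι) (i : ι) : setDeg J i = if i ∈ J then 1 else 0 := by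
  simp [setDeg, Finsupp.finsetSum_apply, Finsupp.single_apply]

theorem degree_setDeg (J : Finset ι) : (setDeg J).degree = J.card := by
  simp [setDeg, map_sum]

theorem setDeg_injective : Function.Injective (setDeg : Finset ι → ι →₀ ℕ) := by
  classical
  intro J K h
  ext i
  have := DFunLike.congr_fun h i
  rw [setDeg_apply, setDeg_apply] at this
  split_ifs at this <;> simp_all

theorem exists_setDeg_eq {D : ι →₀ ℕ} (hD : ∀ i, D i ≤ 1) : D = setDeg D.support := by
  classical
  ext i
  have := hD i
  rw [setDeg_apply]
  split_ifs with h <;> rw [Finsupp.mem_support_iff] at h <;> omega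

/-- Pair off the elements of `J` arbitrarily. -/
theorem exists_vdeg_eq_setDeg {e : σ → Sym2 ι} (hs : ∀ i j, i ≠ j → ∃ v, e v = s(i, j))
    (J : Finset ι) (hJ : Even J.card) : ∃ m, vdeg e m = setDeg J := by
  classical
  obtain ⟨c, hc⟩ := hJ
  induction c generalizing J with
  | zero => exact ⟨0, by rw [Finset.card_eq_zero.1 hc]; simp [setDeg]⟩
  | succ c ih =>
    obtain ⟨i, hi, j, hj, hij⟩ := Finset.one_lt_card.1 (by omega : 1 < J.card)
    obtain ⟨v, hv⟩ := hs i j hij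
    have hj' : j ∈ J.erase i := Finset.mem_erase.2 ⟨hij.symm, hj⟩
    obtain ⟨m, hm⟩ := ih ((J.erase i).erase j) (by
      rw [Finset.card_erase_of_mem hj', Finset.card_erase_of_mem hi]; omega)
    refine ⟨Finsupp.single v 1 + m, ?_⟩
    rw [map_add, vdeg_single, hm, hv, edgeDeg_mk, one_smul, setDeg, setDeg, add_assoc,
      Finset.add_sum_erase _ (fun i => Finsupp.single i 1) hj',
      Finset.add_sum_erase _ (fun i => Finsupp.single i 1) hi]

/-- The homomorphism `y_{ij} ↦ t_i t_j`. -/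
def edgeHom (k : Type*) [Field k] (e : σ → Sym2 ι) : MvPolynomial σ k →ₐ[k] MvPolynomial ι k :=
  aeval fun v => monomial (edgeDeg (e v)) 1

theorem edgeHom_monomial (e : σ → Sym2 ι) (m : σ →₀ ℕ) (c : k) :
    edgeHom k e (monomial m c) = monomial (vdeg e m) c := by
  rw [edgeHom, aeval_monomial, vdeg, LinearMap.toAddMonoidHom_coe,
    Finsupp.linearCombination_apply, Finsupp.prod, Finsupp.sum]
  simp only [monomial_pow, one_pow]
  rw [← monomial_sum_one, algebraMap_eq, C_mul_monomial, mul_one]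

theorem coeff_edgeHom (e : σ → Sym2 ι) (Φ : MvPolynomial σ k) (D : ι →₀ ℕ) :
    coeff D (edgeHom k e Φ) =
      open Classical in ∑ a ∈ Φ.support, if vdeg e a = D then coeff a Φ else 0 := by
  classical
  conv_lhs => rw [Φ.as_sum]
  simp only [map_sum, edgeHom_monomial, coeff_sum, coeff_monomial]

theorem degree_eq_of_coeff_edgeHom_ne_zero {e : σ → Sym2 ι} {Φ : MvPolynomial σ k} {d : ℕ}
    (h : Φ.IsHomogeneous d) {D : ι →₀ ℕ} (hD : coeff D (edgeHom k e Φ) ≠ 0) : D.degree = 2 * d := by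
  classical
  rw [coeff_edgeHom] at hD
  obtain ⟨a, ha, hne⟩ := Finset.exists_ne_zero_of_sum_ne_zero hD
  have : vdeg e a = D := by by_contra h; exact hne (if_neg h)
  rw [← this, degree_vdeg, h.degree_eq_sum_deg_support ha]
  rfl

end VertexDegree

/-! ### The apolar ideal as a condition on squarefree coefficients. -/

section ApolarIdeal

variable {ι σ k : Type*} [Field k] [Fintype ι] {e : σ → Sym2 ι}

/-- `F` is the generating function of the perfect matchings: the sum of the monomials that have
degree one at every vertex. -/
def IsMatchingSum (e : σ → Sym2 ι) (F : MvPolynomial σ k) : Prop :=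
  ∀ m, coeff m F = open Classical in if ∀ i, vdeg e m i = 1 then 1 else 0

theorem coeff_contract {F : MvPolynomial σ k} (Φ : MvPolynomial σ k) (b : σ →₀ ℕ) :
    coeff b (contract Φ F) = ∑ a ∈ Φ.support, coeff a Φ * coeff (a + b) F := by
  simp [contract, coeff_sum, coeff_divMonomial]

/-- The monomial `x^(a+b)` occurs in `F` exactly when the vertex degrees of `a` and `b` add up to
one everywhere, that is, when `b` is squarefree on vertices and `a` covers each remaining vertex
once. -/
theorem IsMatchingSum.coeff_contract {F : MvPolynomial σ k} (hF : IsMatchingSum e F)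
    (Φ : MvPolynomial σ k) (b : σ →₀ ℕ) :
    coeff b (contract Φ F) =
      open Classical in if ∀ i, vdeg e b i ≤ 1 then
        coeff (setDeg (Finset.univ \ (vdeg e b).support)) (edgeHom k e Φ) else 0 := by
  classical
  rw [Apolar.coeff_contract]
  split_ifs with hb
  · rw [coeff_edgeHom]
    refine Finset.sum_congr rfl fun a _ => ?_
    have : (∀ i, vdeg e (a + b) i = 1) ↔
        vdeg e a = setDeg (Finset.univ \ (vdeg e b).support) := by
      rw [Finsupp.ext_iff]
      refine forall_congr' fun i => ?_
      have := hb i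
      rw [map_add, Finsupp.add_apply, setDeg_apply]
      split_ifs with h <;> simp at h <;> omega
    rw [hF, if_congr this rfl rfl, mul_ite, mul_one, mul_zero]
  · refine Finset.sum_eq_zero fun a _ => ?_
    rw [hF, if_neg, mul_zero]
    intro h
    refine hb fun i => ?_
    have := h i
    rw [map_add, Finsupp.add_apply] at this
    omega

theorem IsMatchingSum.mem_apolarIdeal_of_coeff_eq_zero {F : MvPolynomial σ k}
    (hF : IsMatchingSum e F) {Φ : MvPolynomial σ k}
    (h : ∀ J, coeff (setDeg J) (edgeHom k e Φ) = 0) : Φ ∈ apolarIdeal F := by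
  change contract Φ F = 0
  ext b
  rw [hF.coeff_contract, coeff_zero]
  split_ifs
  · exact h _
  · rfl

/-- For `J` even the complement is even too, so it is covered by a matching `b`, and the coefficient
is read off at `x^b`. For `J` odd it vanishes because `ε` only produces even degrees. -/
theorem IsMatchingSum.coeff_eq_zero_of_mem_apolarIdeal {F : MvPolynomial σ k}
    (hF : IsMatchingSum e F) (hs : ∀ i j, i ≠ j → ∃ v, e v = s(i, j))
    (hι : Even (Fintype.card ι)) {Φ : MvPolynomial σ k} (h : Φ ∈ apolarIdeal F) (J : Finset ι) :
    coeff (setDeg J) (edgeHom k e Φ) = 0 := by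
  classical
  by_cases hJ : Even J.card
  · obtain ⟨b, hb⟩ := exists_vdeg_eq_setDeg hs Jᶜ
      (by rw [Finset.card_compl, Nat.even_sub (Finset.card_le_univ J)]; tauto)
    have h0 : contract Φ F = 0 := h
    have := hF.coeff_contract Φ b
    rw [h0, coeff_zero, if_pos] at this
    · convert this.symm
      ext i
      simp [hb, setDeg_apply]
    · intro i
      rw [hb, setDeg_apply]
      split_ifs <;> simp
  · rw [coeff_edgeHom]
    refine Finset.sum_eq_zero fun a _ => if_neg fun ha => hJ ?_
    rw [← degree_setDeg, ← ha, degree_vdeg]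
    exact even_two_mul _

theorem IsMatchingSum.monomial_sub_mem {F : MvPolynomial σ k} (hF : IsMatchingSum e F)
    {a b : σ →₀ ℕ} (h : vdeg e a = vdeg e b) (c : k) :
    monomial a c - monomial b c ∈ apolarIdeal F :=
  hF.mem_apolarIdeal_of_coeff_eq_zero fun J => by simp [edgeHom_monomial, h]

theorem IsMatchingSum.monomial_mem {F : MvPolynomial σ k} (hF : IsMatchingSum e F)
    {a : σ →₀ ℕ} {i : ι} (h : 2 ≤ vdeg e a i) (c : k) : monomial a c ∈ apolarIdeal F :=
  hF.mem_apolarIdeal_of_coeff_eq_zero fun J => by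
    classical
    rw [edgeHom_monomial, coeff_monomial, if_neg]
    intro h1
    rw [h1, setDeg_apply] at h
    split_ifs at h <;> omega

end ApolarIdeal

/-! ### Generation of the apolar ideal by loops and quadrics. -/

section Generation

variable {ι σ k : Type*} [Field k] {e : σ → Sym2 ι}

theorem edgeDeg_le_one {x : Sym2 ι} (h : ¬ x.IsDiag) (i : ι) : edgeDeg x i ≤ 1 := by
  classical
  induction x with
  | _ a b =>
    have hab : a ≠ b := by simpa using h
    simp only [edgeDeg_mk, Finsupp.add_apply, Finsupp.single_apply]
    split_ifs <;> simp_all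

theorem exists_eq_single_add {m : σ →₀ ℕ} {v : σ} (h : m v ≠ 0) :
    ∃ m', m = Finsupp.single v 1 + m' :=
  ⟨m - Finsupp.single v 1, (add_tsub_cancel_of_le
    (Finsupp.single_le_iff.2 (Nat.one_le_iff_ne_zero.2 h))).symm⟩

/-- The ideal generated by the variables of the loops and by the quadrics of `Ann(F)`. -/
def loopQuadricIdeal (e : σ → Sym2 ι) (F : MvPolynomial σ k) : Ideal (MvPolynomial σ k) :=
  Ideal.span {Φ | ∃ v, (e v).IsDiag ∧ X v = Φ} ⊔ Ideal.span (formsOfDegree (apolarIdeal F) 2)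

theorem X_mem_loopQuadricIdeal (F : MvPolynomial σ k) {v : σ} (h : (e v).IsDiag) :
    X v ∈ loopQuadricIdeal e F :=
  Ideal.mem_sup_left (Ideal.subset_span ⟨v, h, rfl⟩)

theorem isHomogeneous_monomial_single_add_single (v w : σ) (c : k) :
    (monomial (Finsupp.single v 1 + Finsupp.single w 1) c).IsHomogeneous 2 :=
  isHomogeneous_monomial _ (by simp)

variable [Fintype ι] {F : MvPolynomial σ k}

/-- Either a loop divides the monomial, or two factors (possibly equal) pass through `i`, and their
product is a quadric of the apolar ideal. -/
theorem IsMatchingSum.monomial_mem_loopQuadricIdeal (hF : IsMatchingSum e F) {a : σ →₀ ℕ} {i : ι}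
    (h : 2 ≤ vdeg e a i) : monomial a (1 : k) ∈ loopQuadricIdeal e F := by
  obtain ⟨v, hv, hiv⟩ := exists_mem_support_of_vdeg_ne_zero (by omega : vdeg e a i ≠ 0)
  obtain ⟨a, rfl⟩ := exists_eq_single_add hv
  rw [← mul_one (1 : k), ← monomial_mul]
  by_cases hd : (e v).IsDiag
  · exact Ideal.mul_mem_right _ _ (X_mem_loopQuadricIdeal F hd)
  · rw [map_add, vdeg_single, one_smul, Finsupp.add_apply] at h
    have := edgeDeg_le_one hd i
    obtain ⟨w, hw, hiw⟩ := exists_mem_support_of_vdeg_ne_zero (by omega : vdeg e a i ≠ 0)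
    obtain ⟨a, rfl⟩ := exists_eq_single_add hw
    rw [monomial_mul, ← add_assoc, ← monomial_mul]
    refine Ideal.mul_mem_right _ _ (Ideal.mem_sup_right (Ideal.subset_span ⟨?_, ?_⟩))
    · refine hF.monomial_mem (i := i) ?_ _
      rw [map_add, vdeg_single, vdeg_single, one_smul, one_smul]
      exact add_le_add (one_le_edgeDeg hiv) (one_le_edgeDeg hiw)
    · exact isHomogeneous_monomial_single_add_single v w _

/-- Induction on the number of edges: a common edge cancels, and one exchange move creates a common
edge. -/
theorem IsMatchingSum.monomial_sub_mem_loopQuadricIdeal (hF : IsMatchingSum e F)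
    (he : Function.Injective e) (hs : ∀ i j, i ≠ j → ∃ v, e v = s(i, j)) {a b : σ →₀ ℕ} (hab : vdeg e a = vdeg e b)
    (h1 : ∀ i, vdeg e a i ≤ 1) :
    monomial a (1 : k) - monomial b 1 ∈ loopQuadricIdeal e F := by
  classical
  induction hN : a.degree generalizing a b with
  | zero =>
    have hb : b.degree = 0 := by
      have := congrArg Finsupp.degree hab
      rw [degree_vdeg, degree_vdeg] at this
      omega
    rw [(Finsupp.degree_eq_zero_iff a).1 hN, (Finsupp.degree_eq_zero_iff b).1 hb, sub_self]
    exact zero_mem _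
  | succ N ih =>
    obtain ⟨v, hv⟩ : ∃ v, a v ≠ 0 := by
      by_contra! h
      rw [(Finsupp.ext h : a = 0)] at hN
      simp at hN
    obtain ⟨a, rfl⟩ := exists_eq_single_add hv
    have ha : a.degree = N := by
      rw [map_add, Finsupp.degree_single] at hN
      omega
    have cancel : ∀ c, vdeg e (Finsupp.single v 1 + a) = vdeg e (Finsupp.single v 1 + c) →
        monomial (Finsupp.single v 1 + a) (1 : k) - monomial (Finsupp.single v 1 + c) 1 ∈
          loopQuadricIdeal e F := by
      intro c hc
      rw [← mul_one (1 : k), ← monomial_mul, ← monomial_mul, ← mul_sub]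
      refine Ideal.mul_mem_left _ _ (ih ?_ ?_ ha)
      · rwa [map_add, map_add, add_right_inj] at hc
      · intro i
        refine le_trans ?_ (h1 i)
        rw [map_add]
        simp
    rcases hev : e v with ⟨i, j⟩
    replace hev : e v = s(i, j) := hev
    have hvi : i ∈ e v := by simp [hev]
    have hvj : j ∈ e v := by simp [hev]
    have hpos : ∀ x ∈ e v, vdeg e b x ≠ 0 := by
      intro x hx
      have := one_le_edgeDeg hx
      rw [← hab, map_add, vdeg_single, one_smul, Finsupp.add_apply]
      omega
    obtain ⟨f, hf, hif⟩ := exists_mem_support_of_vdeg_ne_zero (hpos i hvi)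
    obtain ⟨b, rfl⟩ := exists_eq_single_add hf
    by_cases hfv : f = v
    · subst hfv
      exact cancel b hab
    have hb1 := fun i => hab ▸ h1 i
    have hij : i ≠ j := by
      rintro rfl
      have := h1 i
      rw [map_add, vdeg_single, one_smul, Finsupp.add_apply, hev, edgeDeg_mk] at this
      simp at this
      omega
    obtain ⟨l, hl⟩ := hif
    have hjl : j ≠ l := by
      rintro rfl
      exact hfv (he (hl.trans hev.symm))
    have hil : i ≠ l := by
      rintro rfl
      have := hb1 i
      rw [map_add, vdeg_single, one_smul, Finsupp.add_apply, hl, edgeDeg_mk] at this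
      simp at this
      omega
    obtain ⟨g, hg, hjg⟩ : ∃ g, b g ≠ 0 ∧ j ∈ e g := by
      refine exists_mem_support_of_vdeg_ne_zero ?_
      have := hpos j hvj
      rw [map_add, vdeg_single, one_smul, Finsupp.add_apply, hl, edgeDeg_mk] at this
      simpa [Finsupp.single_apply, hij, hjl.symm] using this
    obtain ⟨b, rfl⟩ := exists_eq_single_add hg
    obtain ⟨m, hm⟩ := hjg
    have hlm : l ≠ m := by
      rintro rfl
      have := hb1 l
      simp only [map_add, vdeg_single, one_smul, Finsupp.add_apply, hl, hm, edgeDeg_mk] at this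
      simp at this
      omega
    -- `a` contains `v = ij`, while `b` contains `f = il` and `g = jm`. Replacing `f, g` by `v` and
    -- `u = lm` changes `b` by a multiple of a quadric and gives it the edge `v`.
    obtain ⟨u, hu⟩ := hs l m hlm
    have hswap : vdeg e (Finsupp.single v 1 + Finsupp.single u 1) =
        vdeg e (Finsupp.single f 1 + Finsupp.single g 1) := by
      simp only [map_add, vdeg_single, one_smul, hev, hu, hl, hm, edgeDeg_mk]
      abel
    have hstep : monomial (Finsupp.single v 1 + (Finsupp.single u 1 + b)) (1 : k) -
        monomial (Finsupp.single f 1 + (Finsupp.single g 1 + b)) 1 ∈ loopQuadricIdeal e F := by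
      rw [← add_assoc, ← add_assoc, ← mul_one (1 : k), ← monomial_mul, ← monomial_mul, ← sub_mul]
      exact Ideal.mul_mem_right _ _ (Ideal.mem_sup_right (Ideal.subset_span
        ⟨hF.monomial_sub_mem hswap _, (isHomogeneous_monomial_single_add_single v u _).sub
          (isHomogeneous_monomial_single_add_single f g _)⟩))
    have hdeg : vdeg e (Finsupp.single v 1 + (Finsupp.single u 1 + b)) =
        vdeg e (Finsupp.single f 1 + (Finsupp.single g 1 + b)) := by
      rw [← add_assoc, ← add_assoc, map_add, hswap, ← map_add]
    have := add_mem (cancel _ (hab.trans hdeg.symm)) hstep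
    rwa [sub_add_sub_cancel] at this

theorem IsMatchingSum.apolarIdeal_eq (hF : IsMatchingSum e F) (he : Function.Injective e)
    (hs : ∀ i j, i ≠ j → ∃ v, e v = s(i, j)) (hι : Even (Fintype.card ι)) :
    apolarIdeal F = loopQuadricIdeal e F := by
  classical
  refine le_antisymm ?_ ?_
  -- The quotient map by `loopQuadricIdeal` factors linearly through `ε`: `t^D` goes to the class of
  -- any monomial above it if `D` is squarefree, and to zero otherwise. On the apolar ideal `ε`
  -- yields no squarefree terms, so the quotient map kills it.
  · let rep : (ι →₀ ℕ) → MvPolynomial σ k ⧸ loopQuadricIdeal e F := fun D =>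
      if h : (∀ i, D i ≤ 1) ∧ ∃ a, vdeg e a = D then
        Ideal.Quotient.mk _ (monomial h.2.choose 1) else 0
    let ψ : MvPolynomial ι k →ₗ[k] MvPolynomial σ k ⧸ loopQuadricIdeal e F :=
      (basisMonomials ι k).constr k rep
    have hψ : ∀ D c, ψ (monomial D c) = c • rep D := by
      intro D c
      rw [← (basisMonomials ι k).constr_basis k rep D, coe_basisMonomials, ← map_smul,
        smul_monomial, smul_eq_mul, mul_one]
    have hmk : ∀ Φ, Ideal.Quotient.mk (loopQuadricIdeal e F) Φ = ψ (edgeHom k e Φ) := by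
      intro Φ
      induction Φ using MvPolynomial.induction_on' with
      | add p q hp hq => rw [map_add, hp, hq, map_add, map_add]
      | monomial a c =>
        have hc : Ideal.Quotient.mk (loopQuadricIdeal e F) (monomial a c) =
            c • Ideal.Quotient.mk (loopQuadricIdeal e F) (monomial a (1 : k)) := by
          rw [← Ideal.Quotient.mkₐ_eq_mk k, ← map_smul, smul_monomial, smul_eq_mul, mul_one]
        rw [edgeHom_monomial, hψ, hc]
        congr 1
        by_cases h : ∀ i, vdeg e a i ≤ 1
        · have h' : (∀ i, vdeg e a i ≤ 1) ∧ ∃ b, vdeg e b = vdeg e a := ⟨h, a, rfl⟩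
          simp only [rep, dif_pos h']
          exact Ideal.Quotient.eq.2 (hF.monomial_sub_mem_loopQuadricIdeal he hs
            h'.2.choose_spec.symm h)
        · simp only [rep, dif_neg (fun h' => h (And.left h'))]
          push Not at h
          obtain ⟨i, hi⟩ := h
          exact Ideal.Quotient.eq_zero_iff_mem.2 (hF.monomial_mem_loopQuadricIdeal hi)
    intro Φ hΦ
    rw [← Ideal.Quotient.eq_zero_iff_mem, hmk, (edgeHom k e Φ).as_sum, map_sum]
    refine Finset.sum_eq_zero fun D _ => ?_
    rw [hψ]
    by_cases hD : ∀ i, D i ≤ 1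
    · rw [exists_setDeg_eq hD, hF.coeff_eq_zero_of_mem_apolarIdeal hs hι hΦ, zero_smul]
    · rw [show rep D = 0 from dif_neg fun h => hD h.1, smul_zero]
  · refine sup_le (Ideal.span_le.2 ?_) (Ideal.span_le.2 fun Φ h => h.1)
    rintro _ ⟨v, hv, rfl⟩
    rcases hev : e v with ⟨i, j⟩
    replace hev : e v = s(i, j) := hev
    have hd : s(i, j).IsDiag := by rw [← hev]; exact hv
    obtain rfl : i = j := by simpa using hd
    refine hF.monomial_mem (i := i) ?_ 1
    rw [vdeg_single, one_smul, hev]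
    simp [edgeDeg_mk]

end Generation

/-! ### The sign points. -/

section SignPoints

variable {ι σ k : Type*} [Field k] {e : σ → Sym2 ι}

/-- The point with coordinates `a_i a_j`, for a vector of signs `a`. -/
def signPoint (k : Type*) [Field k] (e : σ → Sym2 ι) (a : ι → ℤˣ) (v : σ) : k :=
  eval (fun i => ((a i : ℤ) : k)) (monomial (edgeDeg (e v)) 1)

theorem signPoint_eq {a : ι → ℤˣ} {v : σ} {i j : ι} (h : e v = s(i, j)) :
    signPoint k e a v = ((a i * a j : ℤˣ) : ℤ) := by
  classical
  rw [signPoint, h, edgeDeg_mk, ← mul_one (1 : k), ← monomial_mul]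
  change eval _ (X i * X j) = _
  simp

theorem signPoint_mul_const (a : ι → ℤˣ) (c : ℤˣ) :
    signPoint k e (fun i => a i * c) = signPoint k e a := by
  funext v
  rcases hev : e v with ⟨i, j⟩
  rw [signPoint_eq hev, signPoint_eq hev, mul_mul_mul_comm, Int.units_mul_self, mul_one]

theorem signPoint_ne_zero (a : ι → ℤˣ) (v : σ) : signPoint k e a v ≠ 0 := by
  rcases hev : e v with ⟨i, j⟩
  rw [signPoint_eq hev]
  rcases Int.units_eq_one_or (a i * a j) with h | h <;> simp [h]

theorem eval_signPoint (a : ι → ℤˣ) (Φ : MvPolynomial σ k) :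
    eval (signPoint k e a) Φ = eval (fun i => ((a i : ℤ) : k)) (edgeHom k e Φ) := by
  induction Φ using MvPolynomial.induction_on with
  | C c => rw [← algebraMap_eq, AlgHom.commutes]; simp [algebraMap_eq]
  | add p q hp hq => rw [map_add, map_add, map_add, hp, hq]
  | mul_X p v hp => rw [map_mul, map_mul, map_mul, hp, eval_X, edgeHom, aeval_X]; rfl

end SignPoints

/-! ### The two bounds for the cactus rank. -/

section CactusBounds

variable {ι σ k : Type*} [Field k] [Fintype ι] {e : σ → Sym2 ι} {F : MvPolynomial σ k}

/-- The coefficients of `ε(Φ)` at `t_J`, `|J| = 2d`, are well defined modulo the apolar ideal and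
independent, since each `t_J` is the image of a monomial. -/
theorem IsMatchingSum.choose_le_hilbertFunction [Finite σ] (hF : IsMatchingSum e F)
    (hs : ∀ i j, i ≠ j → ∃ v, e v = s(i, j)) (hι : Even (Fintype.card ι)) (d : ℕ) :
    (Fintype.card ι).choose (2 * d) ≤ hilbertFunction (apolarIdeal F) d := by
  classical
  let P := Finset.powersetCard (2 * d) (Finset.univ : Finset ι)
  let L : homogeneousSubmodule σ k d →ₗ[k] (P → k) :=
    LinearMap.pi fun J => lcoeff k (setDeg J.1) ∘ₗ (edgeHom k e).toLinearMap ∘ₗ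
      (homogeneousSubmodule σ k d).subtype
  have hL : ∀ Φ J, L Φ J = coeff (setDeg J.1) (edgeHom k e (Φ : MvPolynomial σ k)) :=
    fun _ _ => rfl
  have hker : ((apolarIdeal F).restrictScalars k).comap (homogeneousSubmodule σ k d).subtype ≤
      LinearMap.ker L := by
    intro Φ hΦ
    rw [LinearMap.mem_ker]
    funext J
    rw [hL]
    exact hF.coeff_eq_zero_of_mem_apolarIdeal hs hι hΦ _
  have hcard : ∀ J : P, J.1.card = 2 * d := fun J => (Finset.mem_powersetCard.1 J.2).2
  choose m hm using fun J : P => exists_vdeg_eq_setDeg hs J.1 (by rw [hcard]; exact even_two_mul d)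
  have hmd : ∀ J, (monomial (m J) (1 : k)).IsHomogeneous d := by
    intro J
    refine isHomogeneous_monomial _ ?_
    have := congrArg Finsupp.degree (hm J)
    rw [degree_vdeg, degree_setDeg, hcard] at this
    omega
  have hsurj : Function.Surjective (Submodule.liftQ _ L hker) := by
    intro f
    refine ⟨Submodule.Quotient.mk (∑ J, f J • ⟨monomial (m J) 1, hmd J⟩), ?_⟩
    funext K
    have h1 : ∀ J : P, coeff (setDeg K.1) (edgeHom k e (monomial (m J) 1)) =
        if J = K then (1 : k) else 0 := by
      intro J
      rw [edgeHom_monomial, coeff_monomial, hm]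
      exact if_congr (setDeg_injective.eq_iff.trans Subtype.ext_iff.symm) rfl rfl
    rw [Submodule.liftQ_apply, map_sum, Finset.sum_apply]
    simp [hL, h1]
  have := LinearMap.finrank_le_finrank_of_surjective hsurj
  simpa [P, hilbertFunction] using this

theorem sum_choose_two_mul (m N : ℕ) :
    ∑ d ∈ Finset.range (N + 1), (m + 1).choose (2 * d) =
      ∑ j ∈ Finset.range (2 * N + 1), m.choose j := by
  induction N with
  | zero => simp
  | succ N ih =>
    rw [Finset.sum_range_succ, ih, show 2 * (N + 1) = 2 * N + 1 + 1 by ring,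
      Nat.choose_succ_succ, Finset.sum_range_succ _ (2 * N + 1 + 1),
      Finset.sum_range_succ _ (2 * N + 1), add_assoc]

theorem sum_choose_even {n : ℕ} (hn : 1 ≤ n) :
    ∑ d ∈ Finset.range (n + 1), (2 * n).choose (2 * d) = 2 ^ (2 * n - 1) := by
  have h : 2 * n = 2 * n - 1 + 1 := by omega
  -- By Pascal's rule the sum is that of the whole row `2n - 1`; its extra term `j = 2n` is zero.
  rw [h, sum_choose_two_mul, Finset.sum_range_succ, Nat.choose_eq_zero_of_lt (by omega), add_zero]
  conv_lhs => rw [h]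
  exact Nat.sum_range_choose _

theorem IsMatchingSum.le_of_isPunctualSchemeIdeal [Finite σ] (hF : IsMatchingSum e F)
    (hs : ∀ i j, i ≠ j → ∃ v, e v = s(i, j)) {n : ℕ} (hn : 1 ≤ n) (hι : Fintype.card ι = 2 * n)
    {I : Ideal (MvPolynomial σ k)} {s : ℕ} (hI : IsPunctualSchemeIdeal I s)
    (hIF : I ≤ apolarIdeal F) : 2 ^ (2 * n - 2) ≤ s := by
  have hsq : ∀ v : σ, X v ^ 2 ∈ apolarIdeal F := by
    intro v
    rw [X_pow_eq_monomial]
    refine hF.monomial_mem (i := (e v).out.1) ?_ 1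
    rw [vdeg_single, Finsupp.smul_apply, smul_eq_mul]
    have := one_le_edgeDeg (Sym2.out_fst_mem (e v))
    omega
  have h1 := sum_hilbertFunction_le hIF hI hsq (n + 1)
  have h2 : 2 ^ (2 * n - 1) ≤ ∑ d ∈ Finset.range (n + 1), hilbertFunction (apolarIdeal F) d := by
    rw [← sum_choose_even hn]
    refine Finset.sum_le_sum fun d _ => ?_
    rw [← hι]
    exact hF.choose_le_hilbertFunction hs (hι ▸ even_two_mul n) d
  rw [show 2 * n - 1 = 2 * n - 2 + 1 by omega, pow_succ] at h2
  omega

theorem sum_units_pow (n : ℕ) :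
    ∑ u : ℤˣ, ((u : ℤ) : k) ^ n = if Even n then 2 else 0 := by
  rw [UnitsInt.univ, Finset.sum_pair (by decide)]
  split_ifs with h
  · norm_num [h.neg_one_pow]
  · simp [(Nat.not_even_iff_odd.1 h).neg_one_pow]

/-- A form of the degree of `t_J` that vanishes at all sign vectors does not involve `t_J`. -/
theorem coeff_setDeg_eq_zero (h2 : (2 : k) ≠ 0) {G : MvPolynomial ι k} {J : Finset ι}
    (hG : ∀ D, coeff D G ≠ 0 → D.degree = J.card)
    (hv : ∀ a : ι → ℤˣ, eval (fun i => ((a i : ℤ) : k)) G = 0) : coeff (setDeg J) G = 0 := by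
  classical
  -- Pairing with the character `a ↦ ∏_{i ∈ J} a_i` keeps only the exponents congruent to `setDeg J`
  -- modulo `2`. These are all at least `setDeg J`, so equality of degrees leaves `setDeg J` alone.
  have key : ∑ a : ι → ℤˣ, (∏ i, ((a i : ℤ) : k) ^ setDeg J i) *
      eval (fun i => ((a i : ℤ) : k)) G = coeff (setDeg J) G * 2 ^ Fintype.card ι := by
    simp only [eval_eq', Finset.mul_sum]
    rw [Finset.sum_comm]
    have hterm : ∀ D : ι →₀ ℕ, ∑ a : ι → ℤˣ, (∏ i, ((a i : ℤ) : k) ^ setDeg J i) *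
        (coeff D G * ∏ i, ((a i : ℤ) : k) ^ D i) =
        coeff D G * ∏ i, if Even (setDeg J i + D i) then 2 else 0 := by
      intro D
      simp only [← sum_units_pow]
      rw [Finset.prod_univ_sum, Fintype.piFinset_univ, Finset.mul_sum]
      refine Finset.sum_congr rfl fun a _ => ?_
      rw [mul_left_comm, ← Finset.prod_mul_distrib]
      simp only [pow_add]
    simp only [hterm]
    rw [Finset.sum_eq_single (setDeg J)]
    · simp
    · intro D hD hne
      have hdeg := hG D (mem_support_iff.1 hD)
      by_contra hprod
      refine hne ?_
      have hle : setDeg J ≤ D := by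
        intro i
        have : Even (setDeg J i + D i) := by
          by_contra hi
          exact hprod (by
            rw [Finset.prod_eq_zero (Finset.mem_univ i) (if_neg hi), mul_zero])
        rw [setDeg_apply] at this ⊢
        split_ifs at this ⊢
        · rw [Nat.even_iff] at this
          omega
        · omega
      have h3 := congrArg Finsupp.degree (tsub_add_cancel_of_le hle)
      rw [map_add, hdeg, degree_setDeg, Nat.add_eq_right, Finsupp.degree_eq_zero_iff] at h3
      rw [← tsub_add_cancel_of_le hle, h3, zero_add]
    · intro h
      rw [notMem_support_iff.1 h, zero_mul]
  simp only [hv, mul_zero, Finset.sum_const_zero] at key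
  exact (mul_eq_zero.1 key.symm).resolve_right (pow_ne_zero _ h2)

theorem IsMatchingSum.exists_isPunctualSchemeIdeal (hF : IsMatchingSum e F) [Nonempty σ]
    (h2 : (2 : k) ≠ 0) {n : ℕ} (hn : 1 ≤ n) (hι : Fintype.card ι = 2 * n) :
    ∃ s ≤ 2 ^ (2 * n - 1), ∃ I : Ideal (MvPolynomial σ k),
      IsPunctualSchemeIdeal I s ∧ I ≤ apolarIdeal F := by
  classical
  obtain ⟨i₀⟩ : Nonempty ι := Fintype.card_pos_iff.1 (by omega)
  -- Since `a` and `-a` give the same point, the sign at `i₀` is normalised to `1`, which leaves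
  -- `2^(2n-1)` vectors.
  let ext : ({i // i ≠ i₀} → ℤˣ) → ι → ℤˣ := fun z i => if h : i ≠ i₀ then z ⟨i, h⟩ else 1
  obtain ⟨s, hs, hI⟩ := exists_isPunctualSchemeIdeal_pointsIdeal
    (p := fun z => signPoint k e (ext z)) (v₀ := Classical.arbitrary σ)
    fun z => signPoint_ne_zero _ _
  refine ⟨s, hs.trans_eq ?_, _, hI, fun Φ hΦ => hF.mem_apolarIdeal_of_coeff_eq_zero fun J => ?_⟩
  · rw [Fintype.card_fun, Fintype.card_subtype_compl, Fintype.card_subtype_eq, hι]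
    rfl
  · rw [← sum_homogeneousComponent Φ, map_sum, coeff_sum]
    refine Finset.sum_eq_zero fun d _ => ?_
    have hhom := homogeneousComponent_isHomogeneous d Φ
    by_cases hJ : J.card = 2 * d
    · refine coeff_setDeg_eq_zero h2
        (fun D hD => (degree_eq_of_coeff_edgeHom_ne_zero hhom hD).trans hJ.symm) fun a => ?_
      have ha : ext (fun i => a i * a i₀) = fun i => a i * a i₀ := by
        funext i
        by_cases h : i = i₀
        · simp [ext, h, Int.units_mul_self]
        · simp [ext, h]
      have := mem_pointsIdeal_iff_eval.1 hΦ (fun i => a i * a i₀) d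
      rwa [ha, signPoint_mul_const, eval_signPoint] at this
    · by_contra h
      exact hJ ((degree_setDeg J).symm.trans (degree_eq_of_coeff_edgeHom_ne_zero hhom h))

theorem IsMatchingSum.cactusRank_bounds [Finite σ] (hF : IsMatchingSum e F)
    (hs : ∀ i j, i ≠ j → ∃ v, e v = s(i, j)) (h2 : (2 : k) ≠ 0) {n : ℕ} (hn : 1 ≤ n)
    (hι : Fintype.card ι = 2 * n) :
    2 ^ (2 * n - 2) ≤ cactusRank F ∧ cactusRank F ≤ 2 ^ (2 * n - 1) := by
  obtain ⟨i, j, hij⟩ := Fintype.one_lt_card_iff.1 (by omega : 1 < Fintype.card ι)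
  have : Nonempty σ := ⟨(hs i j hij).choose⟩
  obtain ⟨s, hle, I, hI, hIF⟩ := hF.exists_isPunctualSchemeIdeal h2 hn hι
  have hmem : s ∈ {s : ℕ | ∃ I : Ideal (MvPolynomial σ k),
      IsPunctualSchemeIdeal I s ∧ I ≤ apolarIdeal F} := ⟨I, hI, hIF⟩
  refine ⟨?_, (Nat.sInf_le hmem).trans hle⟩
  obtain ⟨I', hI', hIF'⟩ := Nat.sInf_mem ⟨s, hmem⟩
  exact hF.le_of_isPunctualSchemeIdeal hs hn hι hI' hIF'

end CactusBounds

/-! ### The Hafnian as the sum over perfect matchings. -/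

section HafnianCoefficients

variable {n : ℕ} {k : Type*} [Field k]

theorem oddPos_lt_evenPos (i : Fin n) : oddPos i < evenPos i := by
  simp [oddPos, evenPos, Fin.lt_def]

/-- The positions `1, …, 2n` split into the odd and the even ones. -/
def posEquiv (n : ℕ) : Fin n ⊕ Fin n ≃ Fin (2 * n) :=
  Equiv.ofBijective (Sum.elim oddPos evenPos) (by
    constructor
    · rintro (i | i) (j | j) h <;> simp [oddPos, evenPos, Fin.ext_iff] at h ⊢ <;> omega
    · intro j
      have hj := j.2
      rcases Nat.even_or_odd' j.1 with ⟨c, hc | hc⟩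
      · exact ⟨Sum.inl ⟨c, by omega⟩, by simp [oddPos, Fin.ext_iff, hc]⟩
      · exact ⟨Sum.inr ⟨c, by omega⟩, by simp [evenPos, Fin.ext_iff, hc]⟩)

theorem posEquiv_inl (i : Fin n) : posEquiv n (Sum.inl i) = oddPos i := rfl

theorem posEquiv_inr (i : Fin n) : posEquiv n (Sum.inr i) = evenPos i := rfl

/-- The edges `{τ(2i - 1), τ(2i)}`, as an exponent. -/
def matchingExponent (τ : Equiv.Perm (Fin (2 * n))) : SymVar n →₀ ℕ :=
  ∑ i : Fin n, Finsupp.single s(τ (oddPos i), τ (evenPos i)) 1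

theorem hafnian_genericSymm_eq (k : Type*) [Field k] (n : ℕ) :
    hafnian (genericSymm k n) = ∑ τ ∈ matchingPerms n, monomial (matchingExponent τ) 1 := by
  refine Finset.sum_congr rfl fun τ _ => ?_
  rw [matchingExponent, monomial_sum_one]
  rfl

theorem vdeg_matchingExponent (τ : Equiv.Perm (Fin (2 * n))) (j : Fin (2 * n)) :
    vdeg id (matchingExponent τ) j = 1 := by
  have h : vdeg id (matchingExponent τ) = ∑ j : Fin (2 * n), Finsupp.single j 1 := by
    rw [matchingExponent, map_sum, ← Equiv.sum_comp τ, ← Equiv.sum_comp (posEquiv n),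
      Fintype.sum_sum_type, ← Finset.sum_add_distrib]
    refine Finset.sum_congr rfl fun i _ => ?_
    rw [vdeg_single, one_smul, posEquiv_inl, posEquiv_inr]
    rfl
  rw [h, Finsupp.finsetSum_apply]
  simp [Finsupp.single_apply]

theorem matchingExponent_ne_zero_iff {τ : Equiv.Perm (Fin (2 * n))} {x : SymVar n} :
    matchingExponent τ x ≠ 0 ↔ ∃ i, s(τ (oddPos i), τ (evenPos i)) = x := by
  classical
  simp [matchingExponent, Finsupp.finsetSum_apply, Finsupp.single_apply]

/-- The edges determine the set of smaller endpoints, its increasing enumeration gives the odd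
positions of `τ`, and the partners give the even ones. -/
theorem matchingExponent_injOn :
    Set.InjOn (matchingExponent (n := n)) (matchingPerms n) := by
  intro τ hτ τ' hτ' h
  simp only [matchingPerms, Finset.coe_filter, Finset.mem_univ, true_and, Set.mem_ofPred_eq]
    at hτ hτ'
  have hsub : ∀ {τ τ' : Equiv.Perm (Fin (2 * n))}, (∀ i, τ (oddPos i) < τ (evenPos i)) →
      (∀ i, τ' (oddPos i) < τ' (evenPos i)) → matchingExponent τ = matchingExponent τ' →
      ∀ i, ∃ j, τ' (oddPos j) = τ (oddPos i) ∧ τ' (evenPos j) = τ (evenPos i) := by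
    intro τ τ' h1 h2 h i
    obtain ⟨j, hj⟩ := matchingExponent_ne_zero_iff.1
      (h ▸ matchingExponent_ne_zero_iff.2 ⟨i, rfl⟩ :
        matchingExponent τ' s(τ (oddPos i), τ (evenPos i)) ≠ 0)
    refine ⟨j, (Sym2.eq_iff.1 hj).resolve_right fun hc => ?_⟩
    have h3 := h1 i
    have h4 := h2 j
    rw [hc.1, hc.2] at h4
    exact lt_asymm h3 h4
  have hodd : (fun i => τ (oddPos i)) = fun i => τ' (oddPos i) := by
    refine (StrictMono.range_inj (fun i j => hτ.1 i j) (fun i j => hτ'.1 i j)).1 ?_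
    refine Set.Subset.antisymm ?_ ?_
    · rintro _ ⟨i, rfl⟩
      obtain ⟨j, hj, -⟩ := hsub hτ.2 hτ'.2 h i
      exact ⟨j, hj⟩
    · rintro _ ⟨i, rfl⟩
      obtain ⟨j, hj, -⟩ := hsub hτ'.2 hτ.2 h.symm i
      exact ⟨j, hj⟩
  refine Equiv.ext fun x => ?_
  obtain ⟨i | i, rfl⟩ := (posEquiv n).surjective x
  · exact congrFun hodd i
  · obtain ⟨j, hj, hj'⟩ := hsub hτ.2 hτ'.2 h i
    have : j = i := by
      have := τ'.injective (hj.trans (congrFun hodd i))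
      simpa [oddPos, Fin.ext_iff] using this
    rw [this] at hj'
    exact hj'.symm

/-- Degree one at each vertex yields a fixed-point-free involution `p`, sending a vertex to its
partner; `τ` lists the vertices `j < p j` in increasing order, each followed by its partner. -/
theorem exists_matchingExponent_eq {m : SymVar n →₀ ℕ} (hm : ∀ j, vdeg id m j = 1) :
    ∃ τ ∈ matchingPerms n, matchingExponent τ = m := by
  classical
  have hex : ∀ j, ∃ l, m s(j, l) ≠ 0 := by
    intro j
    obtain ⟨x, hx, l, rfl⟩ := exists_mem_support_of_vdeg_ne_zero
      (by rw [hm]; exact one_ne_zero : vdeg id m j ≠ 0)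
    exact ⟨l, hx⟩
  choose p hp using hex
  have huniq : ∀ j l, m s(j, l) ≠ 0 → l = p j := by
    intro j l hl
    have := eq_of_mem_of_mem (hm j).le hl (hp j) (by simp) (by simp)
    exact Sym2.congr_right.1 this
  have hpp : ∀ j, p (p j) = j := fun j => (huniq _ _ (by rw [Sym2.eq_swap]; exact hp j)).symm
  have hne : ∀ j, p j ≠ j := by
    intro j hj
    have hle : Finsupp.single s(j, j) 1 ≤ m := by
      have := hp j
      rw [hj] at this
      exact Finsupp.single_le_iff.2 (Nat.one_le_iff_ne_zero.2 this)
    have := vdeg_mono id hle j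
    rw [hm, vdeg_single, one_smul, id, edgeDeg_mk] at this
    simp at this
  let A : Finset (Fin (2 * n)) := {j | j < p j}
  have hAc : Aᶜ = A.image p := by
    ext j
    simp only [A, Finset.mem_compl, Finset.mem_filter, Finset.mem_univ, true_and, not_lt,
      Finset.mem_image]
    constructor
    · intro h
      exact ⟨p j, by rw [hpp]; exact lt_of_le_of_ne h (hne j), hpp j⟩
    · rintro ⟨l, hl, rfl⟩
      rw [hpp]
      exact hl.le
  have hinj : Function.Injective p := fun a b h => by rw [← hpp a, h, hpp]
  have hA : A.card = n := by
    have := Finset.card_add_card_compl A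
    rw [hAc, Finset.card_image_of_injective _ hinj, Fintype.card_fin] at this
    omega
  let f := A.orderEmbOfFin hA
  have hf : ∀ i, f i < p (f i) := fun i =>
    (Finset.mem_filter.1 (Finset.orderEmbOfFin_mem A hA i)).2
  let g : Fin n ⊕ Fin n → Fin (2 * n) := Sum.elim f (p ∘ f)
  have hg : Function.Injective g := by
    refine Function.Injective.sumElim f.injective (hinj.comp f.injective) fun i j h => ?_
    have h1 := hf i
    have h2 := hf j
    rw [h] at h1
    simp only [Function.comp_apply, hpp] at h1
    exact lt_asymm h1 h2
  let τ : Equiv.Perm (Fin (2 * n)) := (posEquiv n).symm.trans (Equiv.ofBijective g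
    ((Fintype.bijective_iff_injective_and_card g).2 ⟨hg, Fintype.card_congr (posEquiv n)⟩))
  have hτo : ∀ i, τ (oddPos i) = f i := fun i => by
    simp [τ, ← posEquiv_inl, g]
  have hτe : ∀ i, τ (evenPos i) = p (f i) := fun i => by
    simp [τ, ← posEquiv_inr, g]
  refine ⟨τ, ?_, ?_⟩
  · simp only [matchingPerms, Finset.mem_filter, Finset.mem_univ, true_and, hτo, hτe]
    exact ⟨fun i j h => f.strictMono h, hf⟩
  -- The exponent of `τ` is at most `m` and has the same vertex degrees, so the difference has
  -- degree zero.
  · have hle : matchingExponent τ ≤ m := by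
      intro x
      by_cases hx : matchingExponent τ x = 0
      · simp [hx]
      · obtain ⟨i, rfl⟩ := matchingExponent_ne_zero_iff.1 hx
        have h1 : matchingExponent τ s(τ (oddPos i), τ (evenPos i)) ≤ 1 := by
          have hle : Finsupp.single s(τ (oddPos i), τ (evenPos i))
              (matchingExponent τ s(τ (oddPos i), τ (evenPos i))) ≤ matchingExponent τ :=
            Finsupp.single_le_iff.2 le_rfl
          have := vdeg_mono id hle (τ (oddPos i))
          rw [vdeg_matchingExponent, vdeg_single, Finsupp.smul_apply, smul_eq_mul] at this
          exact le_trans (Nat.le_mul_of_pos_right _ (one_le_edgeDeg (by simp))) this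
        refine h1.trans (Nat.one_le_iff_ne_zero.2 ?_)
        rw [hτo, hτe]
        exact hp _
    have hdeg : (m - matchingExponent τ).degree = 0 := by
      have h1 := degree_vdeg id (m - matchingExponent τ)
      have h2 : vdeg id m = vdeg id (matchingExponent τ) :=
        Finsupp.ext fun j => (hm j).trans (vdeg_matchingExponent τ j).symm
      have h3 := congrArg (vdeg id) (tsub_add_cancel_of_le hle)
      rw [map_add, h2, add_eq_right] at h3
      rw [h3, map_zero] at h1
      omega
    rw [Finsupp.degree_eq_zero_iff] at hdeg
    exact le_antisymm hle (tsub_eq_zero_iff_le.1 hdeg)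

theorem isMatchingSum_hafnian_genericSymm (k : Type*) [Field k] (n : ℕ) :
    IsMatchingSum id (hafnian (genericSymm k n)) := by
  classical
  intro m
  simp only [hafnian_genericSymm_eq, coeff_sum, coeff_monomial]
  split_ifs with hm
  · obtain ⟨τ, hτ, rfl⟩ := exists_matchingExponent_eq hm
    rw [Finset.sum_eq_single_of_mem τ hτ, if_pos rfl]
    intro τ' hτ' hne
    exact if_neg fun h => hne (matchingExponent_injOn hτ' hτ h)
  · refine Finset.sum_eq_zero fun τ _ => if_neg ?_
    rintro rfl
    exact hm (vdeg_matchingExponent τ)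

theorem rename_hafnian_genericSymmZeroDiag (k : Type*) [Field k] (n : ℕ) :
    rename Subtype.val (hafnian (genericSymmZeroDiag k n)) = hafnian (genericSymm k n) := by
  rw [hafnian, hafnian, map_sum]
  refine Finset.sum_congr rfl fun τ _ => ?_
  rw [map_prod]
  refine Finset.prod_congr rfl fun i _ => ?_
  have hne : τ (oddPos i) ≠ τ (evenPos i) := τ.injective.ne (oddPos_lt_evenPos i).ne
  rw [genericSymmZeroDiag, dif_neg hne, rename_X]
  rfl

theorem vdeg_mapDomain (m : OffDiagVar n →₀ ℕ) :
    vdeg id (m.mapDomain Subtype.val) = vdeg Subtype.val m := by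
  induction m using Finsupp.induction_linear with
  | zero => simp
  | add f g hf hg => rw [Finsupp.mapDomain_add, map_add, map_add, hf, hg]
  | single v c => rw [Finsupp.mapDomain_single, vdeg_single, vdeg_single, id]

theorem isMatchingSum_hafnian_genericSymmZeroDiag (k : Type*) [Field k] (n : ℕ) :
    IsMatchingSum Subtype.val (hafnian (genericSymmZeroDiag k n)) := by
  intro m
  rw [← coeff_rename_mapDomain _ Subtype.val_injective, rename_hafnian_genericSymmZeroDiag,
    isMatchingSum_hafnian_genericSymm, vdeg_mapDomain]

end HafnianCoefficients

end Apolar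

end

theorem theorem4p14 {k : Type*} [Field k] (hk : ringChar k ≠ 2) (n : ℕ) (hn : 1 ≤ n) :
    -- in the ring of the off-diagonal entries, the apolar ideal is generated in degree two
    Apolar.GeneratedInDegree
        (Apolar.apolarIdeal (Apolar.hafnian (Apolar.genericSymmZeroDiag k n))) 2 ∧
    -- with the diagonal entries as additional variables, it is generated by the dual variables
    -- `y_ii` and by forms of degree two
    Apolar.apolarIdeal (Apolar.hafnian (Apolar.genericSymm k n)) =
        Ideal.span (Set.range fun i : Fin (2 * n) =>
          (MvPolynomial.X s(i, i) : MvPolynomial (Apolar.SymVar n) k)) ⊔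
        Ideal.span (Apolar.formsOfDegree
          (Apolar.apolarIdeal (Apolar.hafnian (Apolar.genericSymm k n))) 2) ∧
    -- the bounds for the cactus rank, in either ring
    (2 ^ (2 * n - 2) ≤ Apolar.cactusRank (Apolar.hafnian (Apolar.genericSymm k n)) ∧
      Apolar.cactusRank (Apolar.hafnian (Apolar.genericSymm k n)) ≤ 2 ^ (2 * n - 1)) ∧
    (2 ^ (2 * n - 2) ≤ Apolar.cactusRank (Apolar.hafnian (Apolar.genericSymmZeroDiag k n)) ∧
      Apolar.cactusRank (Apolar.hafnian (Apolar.genericSymmZeroDiag k n)) ≤ 2 ^ (2 * n - 1)) := by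
  have h2 : (2 : k) ≠ 0 := Ring.two_ne_zero hk
  have hcard : Fintype.card (Fin (2 * n)) = 2 * n := Fintype.card_fin _
  have heven : Even (Fintype.card (Fin (2 * n))) := by
    rw [hcard]
    exact even_two_mul n
  have hF := Apolar.isMatchingSum_hafnian_genericSymm k n
  have hF' := Apolar.isMatchingSum_hafnian_genericSymmZeroDiag k n
  have hs : ∀ i j : Fin (2 * n), i ≠ j → ∃ v : Apolar.SymVar n, id v = s(i, j) :=
    fun i j _ => ⟨s(i, j), rfl⟩
  have hs' : ∀ i j : Fin (2 * n), i ≠ j → ∃ v : Apolar.OffDiagVar n, v.1 = s(i, j) :=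
    fun i j hij => ⟨⟨s(i, j), by simpa using hij⟩, rfl⟩
  refine ⟨?_, ?_, hF.cactusRank_bounds hs h2 hn hcard, hF'.cactusRank_bounds hs' h2 hn hcard⟩
  · refine (hF'.apolarIdeal_eq Subtype.val_injective hs' heven).trans ?_
    -- Off the diagonal there are no loops, so only the quadrics remain.
    have : {Φ : MvPolynomial (Apolar.OffDiagVar n) k |
        ∃ v : Apolar.OffDiagVar n, v.1.IsDiag ∧ MvPolynomial.X v = Φ} = ∅ := by
      refine Set.eq_empty_iff_forall_notMem.2 ?_
      rintro _ ⟨v, hv, -⟩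
      exact v.2 hv
    rw [Apolar.loopQuadricIdeal, this, Ideal.span_empty, bot_sup_eq]
  · refine (hF.apolarIdeal_eq Function.injective_id hs heven).trans ?_
    rw [Apolar.loopQuadricIdeal]
    congr 2
    ext Φ
    constructor
    · rintro ⟨v, hv, rfl⟩
      rcases v with ⟨i, j⟩
      obtain rfl : i = j := hv
      exact ⟨i, rfl⟩
    · rintro ⟨i, rfl⟩
      exact ⟨s(i, i), by simp, rfl⟩
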